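/- For a group $G$, let $\mathbb Q/\mathbb Z$ carry the trivial $G$-action and define the Bogomolov multiplier of $G$ by $$B_0(G)=\bigcap_{A}\ker\{\mathrm{res}\colon H^2(G,\mathbb Q/\mathbb Z)\to H^2(A,\mathbb Q/\mathbb Z)\},$$ where $A$ runs over all bicyclic subgroups of $G$ (a group is bicyclic if it is cyclic or isomorphic to a direct product of two cyclic groups). Let $p$ be a prime and $n\ge 2$. Let $\mathrm{UT}_n(\mathbb F_p)$ be the group of all upper unitriangular $n\times n$ matrices over $\mathbb F_p$. For $\ell\ge 1$ let $\mathrm{UT}_n^\ell(\mathbb F_p)$ be its subgroup of all matrices whose first $\ell-1$ diagonals above the main diagonal are zero, and let $\Gamma_{n,\ell}=\mathrm{UT}_n(\mathbb F_p)/\gamma_\ell(\mathrm{UT}_n(\mathbb F_p))$, where $\gamma_1(H)=H$ and $\gamma_{\ell+1}(H)=[\gamma_\ell(H),H]$ is the lower central series. **Theorem.** Let $G$ be a group that is isomorphic to $\mathrm{UT}_n(\mathbb F_p)$, or to $\mathrm{UT}_n^\ell(\mathbb F_p)$ or $\Gamma_{n,\ell}$ for some $\ell$ with $1\le \ell\le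 n-2$. Then $B_0(G)=0$. -/

import Mathlib

open CategoryTheory

universe u

/-- A group is bicyclic if it is cyclic or isomorphic to a direct product of two cyclic groups. -/
def IsBicyclic (A : Type u) [Group A] : Prop :=
  IsCyclic A ∨ ∃ (C D : Type u) (_ : Group C) (_ : Group D),
    IsCyclic C ∧ IsCyclic D ∧ Nonempty (A ≃* C × D)

/-- The trivial `G`-module `ℚ/ℤ`. Scalars and coefficients are copies of `ℤ` and of `ℚ/ℤ` in the
universe of `G`, as Mathlib's group cohomology wants all three in the same universe. -/
noncomputable abbrev trivialQModZ (G : Type u) [Group G] : Rep (ULift.{u} ℤ) G :=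
  Rep.trivial (ULift.{u} ℤ) G (ULift.{u} (AddCircle (1 : ℚ)))

/-- The restriction map `H²(G, ℚ/ℤ) → H²(A, ℚ/ℤ)` for a subgroup `A` of `G`. -/
noncomputable def resH2 {G : Type u} [Group G] (A : Subgroup G) :
    groupCohomology.H2 (trivialQModZ G) ⟶ groupCohomology.H2 (trivialQModZ A) :=
  groupCohomology.map A.subtype (𝟙 (trivialQModZ A)) 2

/-- The Bogomolov multiplier `B₀(G)`: the classes in `H²(G, ℚ/ℤ)` whose restriction to every
bicyclic subgroup of `G` is zero. -/
noncomputable def bogomolovMultiplier (G : Type u) [Group G] :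
    Submodule (ULift.{u} ℤ) (groupCohomology.H2 (trivialQModZ G)) :=
  ⨅ (A : Subgroup G) (_ : IsBicyclic A), LinearMap.ker (resH2 A).hom

/-- A submonoid of a finite group is closed under inverses. -/
theorem Submonoid.inv_mem_of_finite_group {G : Type*} [Group G] [Finite G] (S : Submonoid G)
    {g : G} (hg : g ∈ S) : g⁻¹ ∈ S := by
  have h : g⁻¹ = g ^ (orderOf g - 1) := by
    rw [inv_eq_iff_mul_eq_one, ← pow_succ', Nat.sub_add_cancel (orderOf_pos g), pow_orderOf_eq_one]
  rw [h]
  exact S.pow_mem hg _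

/-- The unitriangular group `UT_n(𝔽_p)`: the invertible `n × n` matrices over `𝔽_p` with ones on
the main diagonal and zeros below it. -/
def UT (n p : ℕ) [Fact p.Prime] : Subgroup (GL (Fin n) (ZMod p)) :=
  let S : Submonoid (GL (Fin n) (ZMod p)) :=
    { carrier := {g | (∀ i, g.val i i = 1) ∧ ∀ i j, j < i → g.val i j = 0}
      one_mem' := by
        refine ⟨fun i => by simp, fun i j hij => ?_⟩
        simp [Matrix.one_apply_ne hij.ne']
      mul_mem' := by
        rintro a b ⟨ha, ha'⟩ ⟨hb, hb'⟩
        refine ⟨fun i => ?_, fun i j hij => ?_⟩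
        · rw [Units.val_mul, Matrix.mul_apply, Finset.sum_eq_single i]
          · rw [ha, hb, one_mul]
          · intro k _ hk
            rcases lt_or_gt_of_ne hk with h | h
            · rw [ha' _ _ h, zero_mul]
            · rw [hb' _ _ h, mul_zero]
          · simp
        · rw [Units.val_mul, Matrix.mul_apply]
          refine Finset.sum_eq_zero fun k _ => ?_
          rcases lt_or_ge k i with h | h
          · rw [ha' _ _ h, zero_mul]
          · rw [hb' _ _ (hij.trans_le h), mul_zero] }
  { S with inv_mem' := fun hg => S.inv_mem_of_finite_group hg }

/-- `UT_n^ℓ(𝔽_p)`: the unitriangular matrices whose first `ℓ - 1` diagonals above the main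
diagonal are zero, i.e. the entries `(i, j)` with `0 < j - i < ℓ` vanish. -/
def UTl (n p ℓ : ℕ) [Fact p.Prime] : Subgroup (UT n p) :=
  let S : Submonoid (UT n p) :=
    { carrier := {g | ∀ i j : Fin n, i < j → (j : ℕ) < i + ℓ → g.val.val i j = 0}
      one_mem' := by
        intro i j hij _
        simp [Matrix.one_apply_ne hij.ne]
      mul_mem' := by
        intro a b ha hb i j hij hl
        rw [Subgroup.coe_mul, Units.val_mul, Matrix.mul_apply]
        refine Finset.sum_eq_zero fun k _ => ?_
        rcases lt_trichotomy k i with h | h | h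
        · rw [a.2.2 _ _ h, zero_mul]
        · subst h
          rw [hb _ _ hij hl, mul_zero]
        · rcases le_or_gt k j with h' | h'
          · rw [ha i k h (lt_of_le_of_lt h' hl), zero_mul]
          · rw [b.2.2 _ _ h', mul_zero] }
  { S with inv_mem' := fun hg => S.inv_mem_of_finite_group hg }

/-- The term `γ_ℓ(G)` of the lower central series, indexed from one: `γ₁(G) = G` and
`γ_{ℓ+1}(G) = [γ_ℓ(G), G]` (Mathlib's series starts at index zero). Meaningful for `ℓ ≥ 1`. -/
abbrev lowerCentralTerm (G : Type*) [Group G] (ℓ : ℕ) : Subgroup G :=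
  (⊤ : Subgroup G).lowerCentralSeries (ℓ - 1)

/-- The quotient `Γ_{n,ℓ} = UT_n(𝔽_p) / γ_ℓ(UT_n(𝔽_p))`. -/
abbrev UTQuotient (n p ℓ : ℕ) [Fact p.Prime] : Type :=
  UT n p ⧸ lowerCentralTerm (UT n p) ℓ

open scoped commutatorElement

/-! ### Two-generated finite abelian groups are bicyclic -/

/-! A class in $B_0(G)$ dies on $\langle g,h\rangle$ for all commuting $g,h$, so its cocycle is
symmetric on commuting pairs, and in the central extension $\pi\colon E\to G$ it defines commuting
pairs lift to commuting pairs. If $[E,E]\cap\ker\pi=1$, then $\ker\pi$ embeds in $E^{ab}$ and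
injectivity of $\mathbb Q/\mathbb Z$ splits the class
(`bogomolovMultiplier_eq_bot_of_commutator_inf_ker`).

All the groups in question are quotients of some $UT_n^\ell$ by the matrices that vanish on the
diagonals $1,\dots,m-1$. Take lifts to $E$ of $1+aE_{ik}$ and $1+bE_{kj}$. Their commutator does not
depend on the lifts, is biadditive, and depends only on $i,j,ab$: a commuting pair of products of
elementary matrices compares two middle indices (`pairing_one_left_eq`). This gives canonical lifts
of the $1+aE_{ij}$ with $j\ge i+2\ell$, additive in $a$, whose span contains $[E,E]$
(`commutator_le_liftFiltration`). For an element of that span lying in $\ker\pi$, the leading lift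
is trivial, so the element moves down the filtration by positions until it is $1$
(`mem_liftFiltration_succ`). -/

theorem IsBicyclic.of_surjective {A : Type u} [CommGroup A] [Finite A]
    (ψ : (Fin 2 → ℤ) →ₗ[ℤ] Additive A) (hψ : Function.Surjective ψ) : IsBicyclic A := by
  let e₁ := ψ.quotKerEquivOfSurjective hψ
  have : Finite ((Fin 2 → ℤ) ⧸ LinearMap.ker ψ) := Finite.of_equiv _ e₁.symm.toEquiv
  let b := Pi.basisFun ℤ (Fin 2)
  -- Finiteness of `A` gives the relation lattice full rank, so Smith normal form splits the
  -- quotient into two cyclic factors.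
  have hr := (Submodule.finiteQuotient_iff (LinearMap.ker ψ)).1 this
  let e₂ := Submodule.quotientEquivPiZMod (LinearMap.ker ψ) b hr
  let d : Fin 2 → ℕ := fun i => (Submodule.smithNormalFormCoeffs b hr i).natAbs
  let e₃ : Additive A ≃+ (Π i, ZMod (d i)) := e₁.symm.toAddEquiv.trans e₂
  let e₄ : Additive A ≃+ ULift.{u} (ZMod (d 0)) × ULift.{u} (ZMod (d 1)) :=
    (e₃.trans (RingEquiv.piFinTwo fun i => ZMod (d i)).toAddEquiv).trans
      (AddEquiv.prodCongr AddEquiv.ulift.symm AddEquiv.ulift.symm)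
  have cyc (m : ℕ) : IsCyclic (Multiplicative (ULift.{u} (ZMod m))) :=
    isCyclic_of_surjective (G' := Multiplicative (ZMod m))
      (AddMonoidHom.toMultiplicative
        (AddEquiv.ulift.symm : ZMod m ≃+ ULift.{u} (ZMod m)).toAddMonoidHom)
      (AddEquiv.ulift.symm : ZMod m ≃+ ULift.{u} (ZMod m)).surjective
  refine Or.inr ⟨Multiplicative (ULift.{u} (ZMod (d 0))), Multiplicative (ULift.{u} (ZMod (d 1))),
    inferInstance, inferInstance, cyc _, cyc _, ⟨?_⟩⟩
  exact MulEquiv.mk' (Additive.ofMul.trans (e₄.toEquiv.trans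
    (Equiv.prodCongr Multiplicative.ofAdd Multiplicative.ofAdd))) fun x y => e₄.map_add _ _

theorem isBicyclic_closure_pair {G : Type u} [Group G] [Finite G] {g h : G} (hgh : Commute g h) :
    IsBicyclic (Subgroup.closure {g, h}) := by
  have : IsMulCommutative (Subgroup.closure {g, h}) := Subgroup.isMulCommutative_closure (by
    rintro x (rfl | rfl) y (rfl | rfl)
    exacts [rfl, hgh, hgh.symm, rfl])
  let : CommGroup (Subgroup.closure {g, h}) :=
    { (Subgroup.closure {g, h}).toGroup with mul_comm := this.is_comm.comm }
  let g' : Subgroup.closure {g, h} := ⟨g, Subgroup.subset_closure (by simp)⟩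
  let h' : Subgroup.closure {g, h} := ⟨h, Subgroup.subset_closure (by simp)⟩
  let ψ : (Fin 2 → ℤ) →ₗ[ℤ] Additive (Subgroup.closure {g, h}) :=
    Fintype.linearCombination ℤ ![Additive.ofMul g', Additive.ofMul h']
  have hψ (v) : ((ψ v).toMul : G) = g ^ v 0 * h ^ v 1 := by
    simp [ψ, Fintype.linearCombination_apply, g', h']
  refine IsBicyclic.of_surjective ψ fun x => ?_
  obtain ⟨x, hx⟩ := x
  obtain ⟨v, hv⟩ : ∃ v : Fin 2 → ℤ, x = g ^ v 0 * h ^ v 1 := by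
    induction hx using Subgroup.closure_induction with
    | mem x hx =>
      rcases hx with rfl | rfl
      · exact ⟨![1, 0], by simp⟩
      · exact ⟨![0, 1], by simp⟩
    | one => exact ⟨0, by simp⟩
    | mul x y _ _ hx hy =>
      obtain ⟨v, rfl⟩ := hx
      obtain ⟨w, rfl⟩ := hy
      refine ⟨v + w, ?_⟩
      have := (hgh.zpow_zpow (w 0) (v 1)).eq
      simp only [Pi.add_apply, zpow_add, mul_assoc]
      rw [← mul_assoc (h ^ v 1), ← this, mul_assoc]
    | inv x _ hx =>
      obtain ⟨v, rfl⟩ := hx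
      refine ⟨-v, ?_⟩
      simp [(hgh.zpow_zpow (v 0) (v 1)).eq]
  exact ⟨v, Subtype.ext ((hψ v).trans hv.symm)⟩

/-! ### Central extensions attached to cocycles -/

/-- A surjective homomorphism with central kernel for which commuting elements of the quotient
lift to commuting elements. -/
structure IsCommutingCentralExtension {E G : Type*} [Group E] [Group G] (π : E →* G) : Prop where
  surjective : Function.Surjective π
  commute_of_map_eq_one : ∀ z, π z = 1 → ∀ y, Commute z y
  commute_lift : ∀ x y, Commute (π x) (π y) → Commute x y

/-- The underlying set of the central extension of `G` by `M` defined by a `2`-cocycle `f`. -/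
@[ext]
structure CocycleExtension {G M : Type*} (f : G → G → M) where
  coeff : M
  base : G

namespace CocycleExtension

variable {G M : Type*} [Group G] [AddCommGroup M] {f : G → G → M}

theorem cocycle_one_left (hf : ∀ g h j, f (g * h) j + f g h = f h j + f g (h * j)) (g : G) :
    f 1 g = f 1 1 := by
  simpa using (hf 1 1 g).symm

theorem cocycle_one_right (hf : ∀ g h j, f (g * h) j + f g h = f h j + f g (h * j)) (g : G) :
    f g 1 = f 1 1 := by
  simpa using hf g 1 1

/-- The group structure on the central extension defined by a `2`-cocycle. -/
abbrev group (hf : ∀ g h j, f (g * h) j + f g h = f h j + f g (h * j)) :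
    Group (CocycleExtension f) :=
  letI : Mul (CocycleExtension f) := ⟨fun x y => ⟨x.coeff + y.coeff + f x.base y.base,
    x.base * y.base⟩⟩
  -- The cocycle is not normalized: `f 1 g = f 1 1`, whence the shift by `-f 1 1` here and in the
  -- embedding of the kernel.
  letI : One (CocycleExtension f) := ⟨⟨-f 1 1, 1⟩⟩
  letI : Inv (CocycleExtension f) := ⟨fun x => ⟨-x.coeff - f x.base⁻¹ x.base - f 1 1, x.base⁻¹⟩⟩
  Group.ofLeftAxioms
    (fun x y z => CocycleExtension.ext (by
      change x.coeff + y.coeff + f x.base y.base + z.coeff + f (x.base * y.base) z.base =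
        x.coeff + (y.coeff + z.coeff + f y.base z.base) + f x.base (y.base * z.base)
      have := hf x.base y.base z.base
      rw [← sub_eq_zero] at this ⊢
      rw [← this]
      abel) (mul_assoc _ _ _))
    (fun x => CocycleExtension.ext (by
      change -f 1 1 + x.coeff + f 1 x.base = x.coeff
      rw [cocycle_one_left hf x.base]
      abel) (one_mul _))
    (fun x => CocycleExtension.ext (by
      change -x.coeff - f x.base⁻¹ x.base - f 1 1 + x.coeff + f x.base⁻¹ x.base = -f 1 1
      abel) (inv_mul_cancel _))

end CocycleExtension

theorem exists_coboundary_of_commutator_inf_ker {G : Type u} [Group G]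
    (H : ∀ (E : Type u) [Group E] (π : E →* G), IsCommutingCentralExtension π →
      ∀ z ∈ commutator E, π z = 1 → z = 1)
    {f : G → G → ULift.{u} (AddCircle (1 : ℚ))}
    (hf : ∀ g h j, f (g * h) j + f g h = f h j + f g (h * j))
    (hcomm : ∀ g h, Commute g h → f g h = f h g) :
    ∃ b : G → ULift.{u} (AddCircle (1 : ℚ)), ∀ g h, b h - b (g * h) + b g = f g h := by
  let := CocycleExtension.group hf
  let M := ULift.{u} (AddCircle (1 : ℚ))
  let π : CocycleExtension f →* G := MonoidHom.mk' CocycleExtension.base fun _ _ => rfl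
  have hπ : IsCommutingCentralExtension π := by
    refine ⟨fun g => ⟨⟨0, g⟩, rfl⟩, ?_, ?_⟩
    · intro z hz y
      refine CocycleExtension.ext ?_ ?_
      · change z.coeff + y.coeff + f z.base y.base = y.coeff + z.coeff + f y.base z.base
        rw [show z.base = 1 from hz, CocycleExtension.cocycle_one_left hf y.base,
          CocycleExtension.cocycle_one_right hf y.base]
        abel
      · change z.base * y.base = y.base * z.base
        rw [show z.base = 1 from hz, one_mul, mul_one]
    · intro x y hxy
      refine CocycleExtension.ext ?_ hxy
      change x.coeff + y.coeff + f x.base y.base = y.coeff + x.coeff + f y.base x.base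
      rw [hcomm x.base y.base hxy]
      abel
  let ι : M →+ Additive (Abelianization (CocycleExtension f)) :=
    AddMonoidHom.mk' (fun z => Additive.ofMul (Abelianization.of ⟨z - f 1 1, 1⟩)) fun z w => by
      rw [← ofMul_mul, ← map_mul]
      congr 2
      refine CocycleExtension.ext ?_ (one_mul 1).symm
      change z + w - f 1 1 = z - f 1 1 + (w - f 1 1) + f 1 1
      abel
  have hι : Function.Injective ι := by
    refine (injective_iff_map_eq_zero _).2 fun z hz => ?_
    have h1 : (⟨z - f 1 1, 1⟩ : CocycleExtension f) ∈ commutator (CocycleExtension f) :=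
      (QuotientGroup.eq_one_iff _).1 hz
    have h2 := congrArg CocycleExtension.coeff (H _ π hπ _ h1 rfl)
    change z - f 1 1 = -f 1 1 at h2
    simpa [sub_eq_add_neg] using h2
  -- Injectivity of $\mathbb Q/\mathbb Z$ extends the identity character of the kernel to $E^{ab}$;
  -- evaluating it on the section `g ↦ ⟨0, g⟩` yields the cochain that bounds `f`.
  obtain ⟨r, hr⟩ := CharacterModule.dual_surjective_of_injective ι.toIntLinearMap hι
    (AddEquiv.ulift : M ≃+ AddCircle (1 : ℚ)).toAddMonoidHom
  have hr' (z : M) : r (ι z) = z.down := DFunLike.congr_fun hr z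
  refine ⟨fun g => ⟨r (Additive.ofMul (Abelianization.of ⟨0, g⟩))⟩, fun g h => ?_⟩
  have key : (⟨0, g⟩ * ⟨0, h⟩ : CocycleExtension f) = ⟨f g h - f 1 1, 1⟩ * ⟨0, g * h⟩ := by
    refine CocycleExtension.ext ?_ (one_mul _).symm
    change 0 + 0 + f g h = f g h - f 1 1 + 0 + f 1 (g * h)
    rw [CocycleExtension.cocycle_one_left hf (g * h)]
    abel
  have key' := congrArg (fun x => r (Additive.ofMul (Abelianization.of x))) key
  simp only [map_mul, ofMul_mul, map_add] at key'
  have h3 := hr' (f g h)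
  change r (Additive.ofMul (Abelianization.of ⟨f g h - f 1 1, 1⟩)) = _ at h3
  rw [h3] at key'
  refine ULift.ext _ _ ?_
  change r _ - r _ + r _ = _
  rw [sub_add_eq_add_sub, add_comm, key']
  abel

theorem bogomolovMultiplier_eq_bot_of_commutator_inf_ker {G : Type u} [Group G] [Finite G]
    (H : ∀ (E : Type u) [Group E] (π : E →* G), IsCommutingCentralExtension π →
      ∀ z ∈ commutator E, π z = 1 → z = 1) :
    bogomolovMultiplier G = ⊥ := by
  refine (Submodule.eq_bot_iff _).2 fun ξ hξ => ?_
  simp only [bogomolovMultiplier, Submodule.mem_iInf, LinearMap.mem_ker] at hξ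
  induction ξ using groupCohomology.H2_induction_on with | h f => ?_
  have hcomm (g h : G) (hgh : Commute g h) : f (g, h) = f (h, g) := by
    have hA := hξ _ (isBicyclic_closure_pair hgh)
    have h1 : groupCohomology.H2π _ (groupCohomology.mapCocycles₂
        (Subgroup.closure {g, h}).subtype (𝟙 (trivialQModZ (Subgroup.closure {g, h}))) f) = 0 :=
      (groupCohomology.H2π_comp_map_apply _ _ f).symm.trans hA
    rw [groupCohomology.H2π_eq_zero_iff] at h1
    obtain ⟨b, hb⟩ := h1
    let g' : Subgroup.closure {g, h} := ⟨g, Subgroup.subset_closure (by simp)⟩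
    let h' : Subgroup.closure {g, h} := ⟨h, Subgroup.subset_closure (by simp)⟩
    have e1 : b h' - b (g' * h') + b g' = f (g, h) := congrFun hb (g', h')
    have e2 : b g' - b (h' * g') + b h' = f (h, g) := congrFun hb (h', g')
    -- A coboundary with trivial action is symmetric on commuting pairs.
    have e3 : g' * h' = h' * g' := Subtype.ext hgh
    rw [← e1, ← e2, e3]
    abel
  rw [groupCohomology.H2π_eq_zero_iff]
  obtain ⟨b, hb⟩ := exists_coboundary_of_commutator_inf_ker H (f := fun g h => f (g, h))
    (fun g h j => (groupCohomology.mem_cocycles₂_iff _).1 f.2 g h j) hcomm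
  exact ⟨b, funext fun x => hb x.1 x.2⟩

/-! ### Unitriangular matrices -/

section Unitriangular

variable {n p ℓ : ℕ} [Fact p.Prime]

/-- The embedding of `UT_n^ℓ(𝔽_p)` into the matrix ring. -/
def UTl.mat : UTl n p ℓ →* Matrix (Fin n) (Fin n) (ZMod p) :=
  (Units.coeHom _).comp ((UT n p).subtype.comp (UTl n p ℓ).subtype)

namespace UTl

theorem mat_injective : Function.Injective (mat : UTl n p ℓ → _) := fun _ _ h =>
  Subtype.ext (Subtype.ext (Units.ext h))

theorem mat_diag (g : UTl n p ℓ) (i : Fin n) : mat g i i = 1 := g.1.2.1 i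

theorem mat_lower (g : UTl n p ℓ) {i j : Fin n} (h : j < i) : mat g i j = 0 := g.1.2.2 i j h

theorem mat_band (g : UTl n p ℓ) {i j : Fin n} (h : i < j) (hl : (j : ℕ) < i + ℓ) :
    mat g i j = 0 := g.2 i j h hl

theorem ext_above {g h : UTl n p ℓ} (H : ∀ i j, i < j → mat g i j = mat h i j) : g = h := by
  refine mat_injective (Matrix.ext fun i j => ?_)
  rcases lt_trichotomy i j with hij | rfl | hij
  · exact H i j hij
  · rw [mat_diag, mat_diag]
  · rw [mat_lower _ hij, mat_lower _ hij]

variable [NeZero ℓ]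

theorem lt_of_add_le {i j : Fin n} (h : (i : ℕ) + ℓ ≤ j) : i < j := by
  have := NeZero.pos ℓ
  exact Fin.lt_def.2 (by omega)

/-- The elementary matrix `1 + a E_ij` as an element of `UT_n^ℓ(𝔽_p)`. -/
def elem (i j : Fin n) (h : (i : ℕ) + ℓ ≤ j) (a : ZMod p) : UTl n p ℓ :=
  ⟨⟨⟨Matrix.transvection i j a, Matrix.transvection i j (-a),
      by rw [Matrix.transvection_mul_transvection_same _ _ (lt_of_add_le h).ne]; simp,
      by rw [Matrix.transvection_mul_transvection_same _ _ (lt_of_add_le h).ne]; simp⟩,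
    by
      have hij := lt_of_add_le h
      refine ⟨fun k => ?_, fun k l hkl => ?_⟩
      · have : ¬ (i = k ∧ j = k) := fun hk => hij.ne (hk.1.trans hk.2.symm)
        simp [Matrix.transvection, this]
      · have : ¬ (i = k ∧ j = l) := by
          rintro ⟨rfl, rfl⟩
          exact hkl.not_gt hij
        simp [Matrix.transvection, this, Matrix.one_apply_ne hkl.ne']⟩,
    by
      intro k l hkl hl
      have : ¬ (i = k ∧ j = l) := by
        rintro ⟨rfl, rfl⟩
        omega
      simp [Matrix.transvection, this, Matrix.one_apply_ne hkl.ne]⟩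

theorem mat_elem (i j : Fin n) (h : (i : ℕ) + ℓ ≤ j) (a : ZMod p) :
    mat (elem i j h a) = 1 + Matrix.single i j a := rfl

theorem elem_add (i j : Fin n) (h : (i : ℕ) + ℓ ≤ j) (a b : ZMod p) :
    elem i j h (a + b) = elem i j h a * elem i j h b := by
  refine mat_injective ?_
  rw [map_mul]
  exact (Matrix.transvection_mul_transvection_same i j (lt_of_add_le h).ne a b).symm

theorem elem_zero (i j : Fin n) (h : (i : ℕ) + ℓ ≤ j) : (elem i j h 0 : UTl n p ℓ) = 1 :=
  mat_injective (by simp [mat_elem])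

theorem elem_neg (i j : Fin n) (h : (i : ℕ) + ℓ ≤ j) (a : ZMod p) :
    elem i j h (-a) = (elem i j h a)⁻¹ := by
  rw [eq_inv_iff_mul_eq_one, ← elem_add, neg_add_cancel, elem_zero]

theorem commute_elem {i j k l : Fin n} (h : (i : ℕ) + ℓ ≤ j) (h' : (k : ℕ) + ℓ ≤ l)
    (hjk : j ≠ k) (hli : l ≠ i) (a b : ZMod p) : Commute (elem i j h a) (elem k l h' b) := by
  refine mat_injective ?_
  simp only [map_mul, mat_elem, mul_add, add_mul, mul_one, one_mul,
    Matrix.single_mul_single_of_ne _ _ _ _ hjk, Matrix.single_mul_single_of_ne _ _ _ _ hli]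
  abel

theorem commutatorElement_elem {i k j : Fin n} (h : (i : ℕ) + ℓ ≤ k) (h' : (k : ℕ) + ℓ ≤ j)
    (a b : ZMod p) : ⁅(elem i k h a : UTl n p ℓ), elem k j h' b⁆ =
      elem i j (h.trans ((Nat.le_add_right _ _).trans h')) (a * b) := by
  have hik := (lt_of_add_le h).ne
  have hkj := (lt_of_add_le h').ne
  have hij := ((lt_of_add_le h).trans (lt_of_add_le h')).ne
  rw [commutatorElement_def, mul_inv_eq_iff_eq_mul, mul_inv_eq_iff_eq_mul]
  refine mat_injective ?_
  simp only [map_mul, mat_elem, mul_add, add_mul, mul_one, one_mul,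
    Matrix.single_mul_single_same, Matrix.single_mul_single_of_ne _ _ _ _ hij.symm,
    Matrix.single_mul_single_of_ne _ _ _ _ hkj.symm, add_zero]
  abel

/-- The opposite signs make $(E_{ik}+E_{ik'})(aE_{kj}-aE_{k'j})$ cancel, and the product in the
other order is zero since $j\ne i$. This is the relation that links two middle indices. -/
theorem commute_elem_mul_elem {i k k' j : Fin n} (h₁ : (i : ℕ) + ℓ ≤ k) (h₂ : (k : ℕ) + ℓ ≤ j)
    (h₁' : (i : ℕ) + ℓ ≤ k') (h₂' : (k' : ℕ) + ℓ ≤ j) (hk : k ≠ k') (a : ZMod p) :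
    Commute (elem i k h₁ 1 * elem i k' h₁' 1) (elem k j h₂ a * elem k' j h₂' (-a)) := by
  have hik := (lt_of_add_le h₁).ne
  have hkj := (lt_of_add_le h₂).ne
  have hik' := (lt_of_add_le h₁').ne
  have hkj' := (lt_of_add_le h₂').ne
  have hij := ((lt_of_add_le h₁).trans (lt_of_add_le h₂)).ne
  refine mat_injective ?_
  simp only [map_mul, mat_elem, mul_add, add_mul, mul_one, one_mul,
    Matrix.single_mul_single_same, Matrix.single_mul_single_of_ne _ _ _ _ hij.symm,
    Matrix.single_mul_single_of_ne _ _ _ _ hk, Matrix.single_mul_single_of_ne _ _ _ _ hk.symm,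
    Matrix.single_mul_single_of_ne _ _ _ _ hkj'.symm,
    Matrix.single_mul_single_of_ne _ _ _ _ hik.symm,
    add_zero]
  rw [← Matrix.single_neg, ← Matrix.single_neg]
  abel

end UTl

/-! ### The filtration of `UT_n^ℓ(𝔽_p)` by entries -/

/-- The rank of the position `(i, j)`: positions are ordered by diagonal, then by row. -/
def entryRank {n : ℕ} (i j : Fin n) : ℕ := (j - i) * n + i

theorem entryRank_inj {n : ℕ} {i j k l : Fin n} (hij : i < j) (hkl : k < l)
    (h : entryRank i j = entryRank k l) : i = k ∧ j = l := by
  unfold entryRank at h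
  have hn : 0 < n := i.pos
  rw [mul_comm, mul_comm _ n] at h
  have h1 := congrArg (· % n) h
  have h2 := congrArg (· / n) h
  simp only [Nat.mul_add_mod, Nat.mod_eq_of_lt i.2, Nat.mod_eq_of_lt k.2] at h1
  simp only [Nat.mul_add_div hn, Nat.div_eq_of_lt i.2, Nat.div_eq_of_lt k.2] at h2
  have hi : i = k := Fin.ext h1
  subst hi
  rw [Fin.lt_def] at hij hkl
  exact ⟨rfl, Fin.ext (by omega)⟩

theorem entryRank_lt_of_sub_lt {n : ℕ} {i j k l : Fin n} (h : (j : ℕ) - i < l - k) :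
    entryRank i j < entryRank k l := by
  unfold entryRank
  have : ((j : ℕ) - i + 1) * n ≤ (l - k) * n := Nat.mul_le_mul_right n h
  have := i.2
  rw [add_mul] at *
  omega

theorem entryRank_lt {n : ℕ} (i j : Fin n) : entryRank i j < n * n := by
  unfold entryRank
  have := i.2
  have := j.2
  have : ((j : ℕ) - i + 1) * n ≤ n * n := by
    rcases Nat.eq_zero_or_pos (i : ℕ) with h | h
    · exact Nat.mul_le_mul_right n (by omega)
    · exact Nat.mul_le_mul_right n (by omega)
  rw [add_mul] at this
  omega

namespace UTl

/-- The subgroup of matrices whose entries of rank less than `N` above the diagonal vanish. -/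
def filtration (n p ℓ : ℕ) [Fact p.Prime] (N : ℕ) : Subgroup (UTl n p ℓ) :=
  let S : Submonoid (UTl n p ℓ) :=
    { carrier := {g | ∀ i j, i < j → entryRank i j < N → mat g i j = 0}
      one_mem' := by
        intro i j hij _
        rw [map_one, Matrix.one_apply_ne hij.ne]
      mul_mem' := by
        intro a b ha hb i j hij hN
        rw [map_mul, Matrix.mul_apply]
        refine Finset.sum_eq_zero fun k _ => ?_
        rcases lt_trichotomy k i with h | h | h
        · rw [mat_lower _ h, zero_mul]
        · subst h
          rw [hb _ _ hij hN, mul_zero]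
        · rcases lt_trichotomy j k with h' | h' | h'
          · rw [mat_lower _ h', mul_zero]
          · subst h'
            rw [ha _ _ hij hN, zero_mul]
          · rw [ha i k h (lt_trans (entryRank_lt_of_sub_lt ?_) hN), zero_mul]
            rw [Fin.lt_def] at h h'
            omega }
  { S with inv_mem' := fun hg => S.inv_mem_of_finite_group hg }

variable [NeZero ℓ]

theorem elem_mem_filtration {N : ℕ} {i j : Fin n} (h : (i : ℕ) + ℓ ≤ j) (hN : N ≤ entryRank i j)
    (a : ZMod p) : elem i j h a ∈ filtration n p ℓ N := by
  intro k l hkl hlt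
  have : ¬ (i = k ∧ j = l) := by
    rintro ⟨rfl, rfl⟩
    omega
  simp [mat_elem, this, Matrix.one_apply_ne hkl.ne]

theorem mat_elem_mul_apply (i j : Fin n) (h : (i : ℕ) + ℓ ≤ j) (a : ZMod p) (g : UTl n p ℓ)
    (l : Fin n) : mat (elem i j h a * g) i l = mat g i l + a * mat g j l := by
  simp [mat_elem, add_mul]

/-- Gaussian elimination: left multiplication by an elementary matrix clears the entry of rank `N`
without disturbing the zeros of smaller rank. -/
theorem mem_closure_elem_of_mem_filtration (N : ℕ) (g : UTl n p ℓ) (hg : g ∈ filtration n p ℓ N) :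
    g ∈ Subgroup.closure {g : UTl n p ℓ | ∃ i j h a, g = elem i j h a} := by
  by_cases hN : n * n ≤ N
  · have : g = 1 := ext_above fun i j hij => by
      rw [hg i j hij ((entryRank_lt i j).trans_le hN), map_one, Matrix.one_apply_ne hij.ne]
    rw [this]
    exact one_mem _
  · by_cases hpos : ∃ i j : Fin n, i < j ∧ entryRank i j = N
    · obtain ⟨i, j, hij, rfl⟩ := hpos
      by_cases h : (i : ℕ) + ℓ ≤ j
      · have key : elem i j h (-mat g i j) * g ∈ filtration n p ℓ (entryRank i j + 1) := by
          intro k l hkl hlt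
          rcases (Nat.lt_succ_iff.1 hlt).lt_or_eq with hlt | heq
          · exact mul_mem (elem_mem_filtration h le_rfl _) hg k l hkl hlt
          · obtain ⟨rfl, rfl⟩ := entryRank_inj hkl hij heq
            rw [mat_elem_mul_apply, mat_diag]
            ring
        have := mem_closure_elem_of_mem_filtration _ _ key
        have hmem : elem i j h (-mat g i j) ∈
            Subgroup.closure {g : UTl n p ℓ | ∃ i j h a, g = elem i j h a} :=
          Subgroup.subset_closure ⟨i, j, h, _, rfl⟩
        exact (Subgroup.mul_mem_cancel_left _ hmem).1 this
      · refine mem_closure_elem_of_mem_filtration (entryRank i j + 1) g fun k l hkl hlt => ?_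
        rcases (Nat.lt_succ_iff.1 hlt).lt_or_eq with hlt | heq
        · exact hg k l hkl hlt
        · obtain ⟨rfl, rfl⟩ := entryRank_inj hkl hij heq
          exact mat_band g hij (not_le.1 h)
    · refine mem_closure_elem_of_mem_filtration (N + 1) g fun k l hkl hlt => ?_
      exact hg k l hkl ((Nat.lt_succ_iff.1 hlt).lt_of_ne fun h => hpos ⟨k, l, hkl, h⟩)
termination_by n * n - N

theorem closure_elem : Subgroup.closure {g : UTl n p ℓ | ∃ i j h a, g = elem i j h a} = ⊤ :=
  (Subgroup.eq_top_iff' _).2 fun g =>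
    mem_closure_elem_of_mem_filtration 0 g fun _ _ _ h => absurd h (Nat.not_lt_zero _)

end UTl

/-! ### The lower central series of `UT_n(𝔽_p)` -/

/-- A matrix all of whose entries below the `d`-th diagonal above the main diagonal vanish. -/
def IsUpperBand {R : Type*} [Zero R] (d : ℕ) (A : Matrix (Fin n) (Fin n) R) : Prop :=
  ∀ i j : Fin n, (j : ℕ) < i + d → A i j = 0

theorem IsUpperBand.mul {R : Type*} [Ring R] {d e : ℕ} {A B : Matrix (Fin n) (Fin n) R}
    (hA : IsUpperBand d A) (hB : IsUpperBand e B) : IsUpperBand (d + e) (A * B) := by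
  intro i j hij
  rw [Matrix.mul_apply]
  refine Finset.sum_eq_zero fun k _ => ?_
  by_cases h : (k : ℕ) < i + d
  · rw [hA i k h, zero_mul]
  · rw [hB k j (by omega), mul_zero]

theorem UT.isUpperBand_zero (g : UT n p) : IsUpperBand 0 g.val.val :=
  fun i j h => g.2.2 i j (Fin.lt_def.2 (by omega))

theorem mem_UTl_iff (g : UT n p) :
    g ∈ UTl n p ℓ ↔ IsUpperBand ℓ (g.val.val - 1) := by
  constructor
  · intro hg i j hij
    rcases lt_trichotomy i j with h | rfl | h
    · rw [Matrix.sub_apply, hg i j h hij, Matrix.one_apply_ne h.ne, sub_zero]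
    · rw [Matrix.sub_apply, g.2.1, Matrix.one_apply_eq, sub_self]
    · rw [Matrix.sub_apply, g.2.2 i j h, Matrix.one_apply_ne h.ne', sub_zero]
  · intro hg i j h hij
    have := hg i j hij
    rwa [Matrix.sub_apply, Matrix.one_apply_ne h.ne, sub_zero] at this

theorem UTl_one : UTl n p 1 = ⊤ := by
  refine (Subgroup.eq_top_iff' _).2 fun g i j hij h => ?_
  rw [Fin.lt_def] at hij
  omega

theorem commutatorElement_mem_UTl {g : UT n p} (hg : g ∈ UTl n p ℓ) (h : UT n p) :
    ⁅g, h⁆ ∈ UTl n p (ℓ + 1) := by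
  have hh : h ∈ UTl n p 1 := UTl_one (n := n) (p := p) ▸ Subgroup.mem_top h
  rw [mem_UTl_iff] at hg
  rw [mem_UTl_iff] at hh
  rw [mem_UTl_iff]
  have hinv : (h * g).val.val * ((h * g)⁻¹).val.val = 1 :=
    (h * g).val.mul_inv
  -- The additive commutator of $g-1$ and $h-1$ starts on diagonal $\ell+1$, and an upper triangular
  -- factor keeps it there.
  have key : (⁅g, h⁆ : UT n p).val.val - 1 =
      ((g.val.val - 1) * (h.val.val - 1) - (h.val.val - 1) * (g.val.val - 1)) *
        ((h * g)⁻¹).val.val := by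
    have e1 : (⁅g, h⁆ : UT n p) = g * h * (h * g)⁻¹ := by
      rw [commutatorElement_def]
      group
    rw [e1]
    nth_rw 1 [← hinv]
    have e2 : (g * h * (h * g)⁻¹).val.val = (g.val.val * h.val.val) * ((h * g)⁻¹).val.val := rfl
    have e3 : (h * g).val.val = h.val.val * g.val.val := rfl
    rw [e2, e3]
    noncomm_ring
  rw [key]
  have h1 := hg.mul hh
  have h2 := hh.mul hg
  rw [add_comm] at h2
  have h3 : IsUpperBand (ℓ + 1)
      ((g.val.val - 1) * (h.val.val - 1) - (h.val.val - 1) * (g.val.val - 1)) := fun i j hij => by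
    rw [Matrix.sub_apply, h1 i j hij, h2 i j hij, sub_zero]
  exact h3.mul (UT.isUpperBand_zero _)

theorem lowerCentralSeries_UT (n p d : ℕ) [Fact p.Prime] :
    (⊤ : Subgroup (UT n p)).lowerCentralSeries d = UTl n p (d + 1) := by
  induction d with
  | zero => exact UTl_one.symm
  | succ d ih =>
    rw [Subgroup.lowerCentralSeries_succ, ih]
    refine le_antisymm (Subgroup.commutator_le.2 fun g hg h _ =>
      commutatorElement_mem_UTl hg h) ?_
    have hgen := congrArg (Subgroup.map (UTl n p (d + 1 + 1)).subtype)
      (UTl.closure_elem (n := n) (p := p) (ℓ := d + 1 + 1))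
    rw [MonoidHom.map_closure, ← MonoidHom.range_eq_map, Subgroup.range_subtype] at hgen
    rw [← hgen, Subgroup.closure_le]
    rintro _ ⟨_, ⟨i, j, h, a, rfl⟩, rfl⟩
    -- This middle index puts $1+aE_{ik}$ in $UT_n^{d+1}$ and still leaves $k<j$.
    let k : Fin n := ⟨i + (d + 1), by omega⟩
    have h1 : (i : ℕ) + 1 ≤ k := by simp only [k]; omega
    have h2 : (k : ℕ) + 1 ≤ j := by simp only [k]; omega
    have hc := congrArg Subtype.val
      (UTl.commutatorElement_elem (p := p) (ℓ := 1) h1 h2 a 1)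
    rw [mul_one] at hc
    have hmem : ((UTl.elem i k h1 a : UTl n p 1) : UT n p) ∈ UTl n p (d + 1) :=
      (UTl.elem (ℓ := d + 1) i k le_rfl a).2
    exact Set.mem_of_eq_of_mem hc.symm
      (Subgroup.commutator_mem_commutator hmem (Subgroup.mem_top _))

end Unitriangular

/-! ### Commutators in central extensions -/

theorem commutatorElement_mul_left_of_commute {E : Type*} [Group E] {x x' y : E}
    (h : Commute ⁅x', y⁆ x) : ⁅x * x', y⁆ = ⁅x', y⁆ * ⁅x, y⁆ := by
  have : ⁅x * x', y⁆ = x * ⁅x', y⁆ * x⁻¹ * ⁅x, y⁆ := by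
    simp only [commutatorElement_def]
    group
  rw [this, ← h.eq, mul_inv_cancel_right]

theorem commutatorElement_mul_right_of_commute {E : Type*} [Group E] {x y y' : E}
    (h : Commute ⁅x, y'⁆ y) : ⁅x, y * y'⁆ = ⁅x, y⁆ * ⁅x, y'⁆ := by
  have : ⁅x, y * y'⁆ = ⁅x, y⁆ * (y * ⁅x, y'⁆ * y⁻¹) := by
    simp only [commutatorElement_def]
    group
  rw [this, ← h.eq, mul_inv_cancel_right]

theorem map_natCast_mul_of_map_add {R E : Type*} [Ring R] [Group E] {F : R → E}
    (hF : ∀ a b, F (a + b) = F a * F b) (m : ℕ) (a : R) : F (m * a) = F a ^ m := by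
  induction m with
  | zero =>
    have := hF 0 0
    rw [add_zero, left_eq_mul] at this
    simpa using this
  | succ m ih => rw [Nat.cast_succ, add_mul, one_mul, hF, ih, pow_succ]

theorem map_neg_of_map_add {R E : Type*} [Ring R] [Group E] {F : R → E}
    (hF : ∀ a b, F (a + b) = F a * F b) (a : R) : F (-a) = (F a)⁻¹ := by
  have := map_natCast_mul_of_map_add hF 0 a
  rw [Nat.cast_zero, zero_mul, pow_zero] at this
  rw [eq_inv_iff_mul_eq_one, ← hF, neg_add_cancel, this]

namespace IsCommutingCentralExtension

variable {E G : Type*} [Group E] [Group G] {π : E →* G}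

theorem commutatorElement_congr (hπ : IsCommutingCentralExtension π) {x x' y y' : E}
    (hx : π x = π x') (hy : π y = π y') : ⁅x, y⁆ = ⁅x', y'⁆ := by
  have left {x x' : E} (y : E) (h : π x = π x') : ⁅x, y⁆ = ⁅x', y⁆ := by
    have hz : π (x'⁻¹ * x) = 1 := by rw [map_mul, map_inv, h, inv_mul_cancel]
    have hc := (hπ.commute_of_map_eq_one _ hz y).eq
    have : x * y * x⁻¹ = x' * y * x'⁻¹ := by
      rw [mul_inv_eq_iff_eq_mul, mul_assoc, mul_assoc, ← hc]
      group
    rw [commutatorElement_def, commutatorElement_def, this]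
  rw [left y hx, ← commutatorElement_inv, left x' hy, commutatorElement_inv]

/-- Reduces statements about all of `E` to lifts of elementary matrices. -/
theorem eq_top_of_lifts_mem (hπ : IsCommutingCentralExtension π) {H : Type*} [Group H] {φ : H →* G}
    (hφ : Function.Surjective φ) {S : Set H} (hS : Subgroup.closure S = ⊤) (K : Subgroup E)
    (hker : π.ker ≤ K) (hK : ∀ g ∈ S, ∀ x, π x = φ g → x ∈ K) : K = ⊤ := by
  have h1 : K.map π = ⊤ := by
    rw [eq_top_iff, ← MonoidHom.range_eq_top.2 hφ, MonoidHom.range_eq_map, ← hS,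
      MonoidHom.map_closure, Subgroup.closure_le]
    rintro _ ⟨g, hg, rfl⟩
    obtain ⟨x, hx⟩ := hπ.surjective (φ g)
    exact ⟨x, hK g hg x hx, hx⟩
  rw [← Subgroup.comap_map_eq_self hker, h1, Subgroup.comap_top]

variable {n p ℓ : ℕ} [Fact p.Prime] [NeZero ℓ] {φ : UTl n p ℓ →* G}

omit [NeZero ℓ] in
theorem commute_of_map_eq (hπ : IsCommutingCentralExtension π) {x y : E} {g h : UTl n p ℓ}
    (hx : π x = φ g) (hy : π y = φ h) (hgh : Commute g h) : Commute x y :=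
  hπ.commute_lift x y (by rw [hx, hy]; exact hgh.map φ)

theorem map_commutatorElement_elem {x y : E} {i k j : Fin n} {h₁ : (i : ℕ) + ℓ ≤ k}
    {h₂ : (k : ℕ) + ℓ ≤ j} (h : (i : ℕ) + ℓ ≤ j) {a b : ZMod p} (hx : π x = φ (UTl.elem i k h₁ a))
    (hy : π y = φ (UTl.elem k j h₂ b)) : π ⁅x, y⁆ = φ (UTl.elem i j h (a * b)) := by
  rw [map_commutatorElement, hx, hy, ← map_commutatorElement, UTl.commutatorElement_elem]

/-- The commutator of lifts of two elementary matrices `1 + a E_ik` and `1 + b E_kj`. -/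
noncomputable def pairing (hπ : IsCommutingCentralExtension π) (φ : UTl n p ℓ →* G)
    {i k j : Fin n} (h₁ : (i : ℕ) + ℓ ≤ k) (h₂ : (k : ℕ) + ℓ ≤ j) (a b : ZMod p) : E :=
  ⁅Function.surjInv hπ.surjective (φ (UTl.elem i k h₁ a)),
    Function.surjInv hπ.surjective (φ (UTl.elem k j h₂ b))⁆

variable (hπ : IsCommutingCentralExtension π) {i k j : Fin n} {h₁ : (i : ℕ) + ℓ ≤ k}
  {h₂ : (k : ℕ) + ℓ ≤ j}

include hπ in
theorem commutatorElement_eq_pairing {x y : E} {a b : ZMod p} (hx : π x = φ (UTl.elem i k h₁ a))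
    (hy : π y = φ (UTl.elem k j h₂ b)) : ⁅x, y⁆ = hπ.pairing φ h₁ h₂ a b :=
  hπ.commutatorElement_congr (hx.trans (Function.surjInv_eq _ _).symm)
    (hy.trans (Function.surjInv_eq _ _).symm)

theorem map_pairing (h : (i : ℕ) + ℓ ≤ j) (a b : ZMod p) :
    π (hπ.pairing φ h₁ h₂ a b) = φ (UTl.elem i j h (a * b)) :=
  map_commutatorElement_elem h (Function.surjInv_eq _ _) (Function.surjInv_eq _ _)

theorem commute_pairing_left {x : E} {k' : Fin n} {h₁' : (i : ℕ) + ℓ ≤ k'} (a b c : ZMod p)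
    (hx : π x = φ (UTl.elem i k' h₁' c)) : Commute (hπ.pairing φ h₁ h₂ a b) x :=
  have h := (h₁.trans (Nat.le_add_right _ _)).trans h₂
  hπ.commute_of_map_eq (hπ.map_pairing h a b) hx
    (UTl.commute_elem _ _ (UTl.lt_of_add_le h).ne' (UTl.lt_of_add_le h₁').ne' _ _)

theorem commute_pairing_right {y : E} {k' : Fin n} {h₂' : (k' : ℕ) + ℓ ≤ j} (a b c : ZMod p)
    (hy : π y = φ (UTl.elem k' j h₂' c)) : Commute (hπ.pairing φ h₁ h₂ a b) y :=
  have h := (h₁.trans (Nat.le_add_right _ _)).trans h₂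
  hπ.commute_of_map_eq (hπ.map_pairing h a b) hy
    (UTl.commute_elem _ _ (UTl.lt_of_add_le h₂').ne' (UTl.lt_of_add_le h).ne' _ _)

theorem pairing_add_left (a a' b : ZMod p) : hπ.pairing φ h₁ h₂ (a + a') b =
    hπ.pairing φ h₁ h₂ a b * hπ.pairing φ h₁ h₂ a' b := by
  obtain ⟨x, hx⟩ := hπ.surjective (φ (UTl.elem i k h₁ a))
  obtain ⟨x', hx'⟩ := hπ.surjective (φ (UTl.elem i k h₁ a'))
  obtain ⟨y, hy⟩ := hπ.surjective (φ (UTl.elem k j h₂ b))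
  rw [add_comm, ← hπ.commutatorElement_eq_pairing (x := x' * x) _ hy,
    ← hπ.commutatorElement_eq_pairing hx hy, ← hπ.commutatorElement_eq_pairing hx' hy]
  · refine commutatorElement_mul_left_of_commute ?_
    rw [hπ.commutatorElement_eq_pairing hx hy]
    exact hπ.commute_pairing_left _ _ _ hx'
  · rw [map_mul, hx, hx', UTl.elem_add, map_mul]

theorem pairing_add_right (a b b' : ZMod p) : hπ.pairing φ h₁ h₂ a (b + b') =
    hπ.pairing φ h₁ h₂ a b * hπ.pairing φ h₁ h₂ a b' := by
  obtain ⟨x, hx⟩ := hπ.surjective (φ (UTl.elem i k h₁ a))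
  obtain ⟨y, hy⟩ := hπ.surjective (φ (UTl.elem k j h₂ b))
  obtain ⟨y', hy'⟩ := hπ.surjective (φ (UTl.elem k j h₂ b'))
  rw [← hπ.commutatorElement_eq_pairing (y := y * y') hx,
    ← hπ.commutatorElement_eq_pairing hx hy, ← hπ.commutatorElement_eq_pairing hx hy']
  · refine commutatorElement_mul_right_of_commute ?_
    rw [hπ.commutatorElement_eq_pairing hx hy']
    exact hπ.commute_pairing_right _ _ _ hy
  · rw [map_mul, hy, hy', UTl.elem_add, map_mul]

/-- Each element of the prime field is a multiple of `1`, so by biadditivity both sides are the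
`b.val`-th power of the pairing of `a` with `1`. -/
theorem pairing_eq_pairing_mul_one (a b : ZMod p) :
    hπ.pairing φ h₁ h₂ a b = hπ.pairing φ h₁ h₂ (a * b) 1 := by
  have h := map_natCast_mul_of_map_add (hπ.pairing_add_right (φ := φ) (h₁ := h₁) (h₂ := h₂) a)
    b.val 1
  have h' := map_natCast_mul_of_map_add
    (F := fun a => hπ.pairing φ h₁ h₂ a 1) (fun a a' => hπ.pairing_add_left a a' 1) b.val a
  rw [ZMod.natCast_zmod_val] at h h'
  rw [mul_one] at h
  rw [h, ← h', mul_comm]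

theorem pairing_one_left_eq {k' : Fin n} (h₁' : (i : ℕ) + ℓ ≤ k') (h₂' : (k' : ℕ) + ℓ ≤ j)
    (a : ZMod p) : hπ.pairing φ h₁ h₂ 1 a = hπ.pairing φ h₁' h₂' 1 a := by
  by_cases hk : k = k'
  · subst hk
    rfl
  have hij : j ≠ i := (UTl.lt_of_add_le ((h₁.trans (Nat.le_add_right _ _)).trans h₂)).ne'
  obtain ⟨x, hx⟩ := hπ.surjective (φ (UTl.elem i k h₁ 1))
  obtain ⟨x', hx'⟩ := hπ.surjective (φ (UTl.elem i k' h₁' 1))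
  obtain ⟨y, hy⟩ := hπ.surjective (φ (UTl.elem k j h₂ a))
  obtain ⟨y', hy'⟩ := hπ.surjective (φ (UTl.elem k' j h₂' (-a)))
  have hxy := hπ.commutatorElement_eq_pairing hx hy
  have hxy' := hπ.commutatorElement_eq_pairing hx' hy'
  have hc1 : ⁅x, y'⁆ = 1 :=
    commutatorElement_eq_one_iff_commute.2 (hπ.commute_of_map_eq hx hy'
      (UTl.commute_elem _ _ hk hij _ _))
  have hc2 : ⁅x', y⁆ = 1 :=
    commutatorElement_eq_one_iff_commute.2 (hπ.commute_of_map_eq hx' hy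
      (UTl.commute_elem _ _ (Ne.symm hk) hij _ _))
  have e1 : ⁅x, y * y'⁆ = ⁅x, y⁆ := by
    rw [commutatorElement_mul_right_of_commute, hc1, mul_one]
    rw [hc1]
    exact Commute.one_left y
  have e2 : ⁅x', y * y'⁆ = ⁅x', y'⁆ := by
    rw [commutatorElement_mul_right_of_commute, hc2, one_mul]
    rw [hxy']
    exact hπ.commute_pairing_right _ _ _ hy
  have e3 : ⁅x * x', y * y'⁆ = ⁅x', y'⁆ * ⁅x, y⁆ := by
    rw [commutatorElement_mul_left_of_commute, e1, e2]
    rw [e2, hxy']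
    exact hπ.commute_pairing_left _ _ _ hx
  -- The images commute, hence so do the lifts; expanding by `e3` leaves the two pairings, with
  -- arguments `a` and `-a`, inverse to each other.
  have e4 : ⁅x * x', y * y'⁆ = 1 := by
    refine commutatorElement_eq_one_iff_commute.2 (hπ.commute_of_map_eq (φ := φ) ?_ ?_
      (UTl.commute_elem_mul_elem h₁ h₂ h₁' h₂' hk a))
    · rw [map_mul, map_mul, hx, hx']
    · rw [map_mul, map_mul, hy, hy']
  rw [e3, hxy, hxy', map_neg_of_map_add (hπ.pairing_add_right 1), inv_mul_eq_one] at e4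
  exact e4.symm

theorem pairing_eq {k' : Fin n} (h₁' : (i : ℕ) + ℓ ≤ k') (h₂' : (k' : ℕ) + ℓ ≤ j)
    {a b a' b' : ZMod p} (hab : a * b = a' * b') :
    hπ.pairing φ h₁ h₂ a b = hπ.pairing φ h₁' h₂' a' b' := by
  rw [hπ.pairing_eq_pairing_mul_one, hπ.pairing_eq_pairing_mul_one a', hab,
    ← one_mul (a' * b'), ← hπ.pairing_eq_pairing_mul_one, ← hπ.pairing_eq_pairing_mul_one]
  exact hπ.pairing_one_left_eq h₁' h₂' _

/-! ### Canonical lifts of elementary matrices -/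

omit [NeZero ℓ] in
theorem add_lt_of_add_add_le {i j : Fin n} (h : (i : ℕ) + ℓ + ℓ ≤ j) : (i : ℕ) + ℓ < n := by
  omega

omit [NeZero ℓ] in
theorem le_of_add_add_le {i j : Fin n} (h : (i : ℕ) + ℓ + ℓ ≤ j) : (i : ℕ) + ℓ ≤ j := by
  omega

/-- The canonical lift of `1 + a E_ij` for `j ≥ i + 2ℓ`. -/
noncomputable def lift (hπ : IsCommutingCentralExtension π) (φ : UTl n p ℓ →* G) (i j : Fin n)
    (h : (i : ℕ) + ℓ + ℓ ≤ j) (a : ZMod p) : E :=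
  hπ.pairing φ (i := i) (k := ⟨i + ℓ, add_lt_of_add_add_le h⟩) (j := j) le_rfl h a 1

include hπ in
theorem commutatorElement_eq_lift {x y : E} {a b : ZMod p} (h : (i : ℕ) + ℓ + ℓ ≤ j)
    (hx : π x = φ (UTl.elem i k h₁ a)) (hy : π y = φ (UTl.elem k j h₂ b)) :
    ⁅x, y⁆ = hπ.lift φ i j h (a * b) := by
  rw [hπ.commutatorElement_eq_pairing hx hy]
  exact hπ.pairing_eq _ _ (mul_one _).symm

theorem map_lift (h : (i : ℕ) + ℓ + ℓ ≤ j) (a : ZMod p) :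
    π (hπ.lift φ i j h a) = φ (UTl.elem i j (le_of_add_add_le h) a) := by
  rw [lift, hπ.map_pairing (le_of_add_add_le h), mul_one]

theorem lift_add (h : (i : ℕ) + ℓ + ℓ ≤ j) (a b : ZMod p) :
    hπ.lift φ i j h (a + b) = hπ.lift φ i j h a * hπ.lift φ i j h b :=
  hπ.pairing_add_left a b 1

theorem lift_zero (h : (i : ℕ) + ℓ + ℓ ≤ j) : hπ.lift φ i j h (0 : ZMod p) = 1 := by
  simpa using map_natCast_mul_of_map_add (hπ.lift_add (φ := φ) h) 0 (0 : ZMod p)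

/-- The lift is a commutator of two elements whose images commute, so those elements commute already
in `E`. -/
theorem lift_eq_one (h : (i : ℕ) + ℓ + ℓ ≤ j) {a : ZMod p}
    (ha : φ (UTl.elem i j (le_of_add_add_le h) a) = 1) : hπ.lift φ i j h a = 1 := by
  refine commutatorElement_eq_one_iff_commute.2 (hπ.commute_lift _ _ ?_)
  rw [← commutatorElement_eq_one_iff_commute, ← map_commutatorElement]
  exact (hπ.map_lift h a).trans ha

/-! ### The filtration of `E` by canonical lifts -/

/-- The subgroup generated by the canonical lifts of the elementary matrices `1 + a E_ij` for
which `j ≥ i + 2ℓ` and the rank of the position `(i, j)` is at least `N`. -/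
def liftFiltration (φ : UTl n p ℓ →* G) (N : ℕ) : Subgroup E :=
  Subgroup.closure {z | ∃ i j h a, N ≤ entryRank i j ∧ z = hπ.lift φ i j h a}

theorem lift_mem_liftFiltration {N : ℕ} (h : (i : ℕ) + ℓ + ℓ ≤ j) (a : ZMod p)
    (hN : N ≤ entryRank i j) : hπ.lift φ i j h a ∈ hπ.liftFiltration φ N :=
  Subgroup.subset_closure ⟨i, j, h, a, hN, rfl⟩

include hπ in
-- When not trivial, the commutator is a canonical lift or the inverse of one, on a longer diagonal
-- and so of larger rank. This makes the filtration normal.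
theorem commutatorElement_lift_mem {N : ℕ} {k l : Fin n} {h' : (k : ℕ) + ℓ ≤ l} {b : ZMod p} {y : E}
    (hy : π y = φ (UTl.elem k l h' b)) (h : (i : ℕ) + ℓ + ℓ ≤ j) (a : ZMod p)
    (hN : N ≤ entryRank i j) : ⁅y, hπ.lift φ i j h a⁆ ∈ hπ.liftFiltration φ N := by
  have hℓ := NeZero.pos ℓ
  by_cases hli : l = i
  · subst hli
    rw [hπ.commutatorElement_eq_lift (by omega) hy (hπ.map_lift h a)]
    exact hπ.lift_mem_liftFiltration _ _ (hN.trans (entryRank_lt_of_sub_lt (by omega)).le)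
  · by_cases hjk : j = k
    · subst hjk
      rw [← commutatorElement_inv, hπ.commutatorElement_eq_lift (by omega) (hπ.map_lift h a) hy]
      exact inv_mem
        (hπ.lift_mem_liftFiltration _ _ (hN.trans (entryRank_lt_of_sub_lt (by omega)).le))
    · rw [commutatorElement_eq_one_iff_commute.2 (hπ.commute_of_map_eq hy (hπ.map_lift h a)
        (UTl.commute_elem _ _ hli hjk _ _))]
      exact one_mem _

include hπ in
theorem conj_mem_liftFiltration {N : ℕ} {k l : Fin n} {h' : (k : ℕ) + ℓ ≤ l} {b : ZMod p} {y : E}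
    (hy : π y = φ (UTl.elem k l h' b)) {s : E} (hs : s ∈ hπ.liftFiltration φ N) :
    y * s * y⁻¹ ∈ hπ.liftFiltration φ N := by
  suffices hπ.liftFiltration φ N ≤ (hπ.liftFiltration φ N).comap (MulAut.conj y).toMonoidHom from
    this hs
  rw [liftFiltration, Subgroup.closure_le]
  rintro _ ⟨i, j, h, a, hN, rfl⟩
  change y * _ * y⁻¹ ∈ hπ.liftFiltration φ N
  have := mul_mem (hπ.commutatorElement_lift_mem hy h a hN) (hπ.lift_mem_liftFiltration h a hN)
  rwa [commutatorElement_def, inv_mul_cancel_right] at this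

theorem liftFiltration_normal (hφ : Function.Surjective φ) (N : ℕ) :
    (hπ.liftFiltration φ N).Normal := by
  rw [← Subgroup.normalizer_eq_top_iff]
  refine hπ.eq_top_of_lifts_mem hφ UTl.closure_elem _ (fun z hz => ?_) ?_
  · refine Subgroup.mem_normalizer_iff.2 fun s => ?_
    rw [(hπ.commute_of_map_eq_one z hz s).eq, mul_inv_cancel_right]
  · rintro _ ⟨k, l, h', b, rfl⟩ y hy
    refine Subgroup.mem_normalizer_iff.2 fun s => ⟨hπ.conj_mem_liftFiltration hy, fun hs => ?_⟩
    have hy' : π y⁻¹ = φ (UTl.elem k l h' (-b)) := by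
      rw [map_inv, hy, UTl.elem_neg, map_inv]
    have := hπ.conj_mem_liftFiltration hy' hs
    simpa [mul_assoc] using this

/-- The quotient of `E` by the span of the lifts is abelian, since lifts of elementary matrices
commute there; centralizers extend this to one argument and then to the other. -/
theorem commutator_le_liftFiltration (hφ : Function.Surjective φ) :
    commutator E ≤ hπ.liftFiltration φ 0 := by
  have := hπ.liftFiltration_normal hφ 0
  let q := QuotientGroup.mk' (hπ.liftFiltration φ 0)
  let K (y : E) : Subgroup E := (Subgroup.centralizer {q y}).comap q
  have hK (x y : E) : x ∈ K y ↔ Commute (q x) (q y) := by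
    rw [Subgroup.mem_comap, Subgroup.mem_centralizer_singleton_iff]
    rfl
  have hker (y : E) : π.ker ≤ K y := fun z hz =>
    (hK z y).2 ((hπ.commute_of_map_eq_one z hz y).map q)
  have hgen {i j k l : Fin n} {h : (i : ℕ) + ℓ ≤ j} {h' : (k : ℕ) + ℓ ≤ l} {a b : ZMod p} {x y : E}
      (hx : π x = φ (UTl.elem i j h a)) (hy : π y = φ (UTl.elem k l h' b)) :
      Commute (q x) (q y) := by
    rw [← commutatorElement_eq_one_iff_commute, ← map_commutatorElement]
    refine (QuotientGroup.eq_one_iff _).2 ?_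
    by_cases hjk : j = k
    · subst hjk
      rw [hπ.commutatorElement_eq_lift (by omega) hx hy]
      exact hπ.lift_mem_liftFiltration _ _ (Nat.zero_le _)
    · by_cases hli : l = i
      · subst hli
        rw [← commutatorElement_inv, hπ.commutatorElement_eq_lift (by omega) hy hx]
        exact inv_mem (hπ.lift_mem_liftFiltration _ _ (Nat.zero_le _))
      · rw [commutatorElement_eq_one_iff_commute.2 (hπ.commute_of_map_eq hx hy
          (UTl.commute_elem _ _ hjk hli _ _))]
        exact one_mem _
  have h1 {k l : Fin n} {h' : (k : ℕ) + ℓ ≤ l} {b : ZMod p} {y : E}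
      (hy : π y = φ (UTl.elem k l h' b)) : K y = ⊤ := by
    refine hπ.eq_top_of_lifts_mem hφ UTl.closure_elem _ (hker y) ?_
    rintro _ ⟨i, j, h, a, rfl⟩ x hx
    exact (hK x y).2 (hgen hx hy)
  have h2 (x : E) : K x = ⊤ := by
    refine hπ.eq_top_of_lifts_mem hφ UTl.closure_elem _ (hker x) ?_
    rintro _ ⟨i, j, h, a, rfl⟩ y hy
    exact (hK y x).2 ((hK x y).1 (h1 hy ▸ Subgroup.mem_top x)).symm
  refine Subgroup.commutator_le.2 fun x _ y _ => (QuotientGroup.eq_one_iff _).1 ?_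
  change q ⁅x, y⁆ = 1
  rw [map_commutatorElement, commutatorElement_eq_one_iff_commute]
  exact (hK x y).1 (h2 y ▸ Subgroup.mem_top x)

theorem exists_mem_filtration_of_mem_liftFiltration {N : ℕ} {z : E}
    (hz : z ∈ hπ.liftFiltration φ N) : ∃ g ∈ UTl.filtration n p ℓ N, φ g = π z := by
  suffices hπ.liftFiltration φ N ≤ ((UTl.filtration n p ℓ N).map φ).comap π from this hz
  rw [liftFiltration, Subgroup.closure_le]
  rintro _ ⟨i, j, h, a, hN, rfl⟩
  exact ⟨_, UTl.elem_mem_filtration _ hN a, (hπ.map_lift h a).symm⟩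

theorem exists_eq_lift_mul (hφ : Function.Surjective φ) (h : (i : ℕ) + ℓ + ℓ ≤ j) {z : E}
    (hz : z ∈ hπ.liftFiltration φ (entryRank i j)) :
    ∃ a, ∃ w ∈ hπ.liftFiltration φ (entryRank i j + 1), z = hπ.lift φ i j h a * w := by
  have := hπ.liftFiltration_normal hφ (entryRank i j + 1)
  let f : Multiplicative (ZMod p) →* E :=
    MonoidHom.mk' (fun a => hπ.lift φ i j h a.toAdd) fun a b => hπ.lift_add h a.toAdd b.toAdd
  have hle : hπ.liftFiltration φ (entryRank i j) ≤
      f.range ⊔ hπ.liftFiltration φ (entryRank i j + 1) := by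
    rw [liftFiltration, Subgroup.closure_le]
    rintro _ ⟨k, l, h', a, hN, rfl⟩
    -- Ranks determine positions, so a generator of the lowest rank sits at `(i, j)` itself.
    rcases hN.eq_or_lt with heq | hlt
    · obtain ⟨rfl, rfl⟩ := entryRank_inj (UTl.lt_of_add_le (le_of_add_add_le h))
        (UTl.lt_of_add_le (le_of_add_add_le h')) heq
      exact Subgroup.mem_sup_left ⟨Multiplicative.ofAdd a, rfl⟩
    · exact Subgroup.mem_sup_right (hπ.lift_mem_liftFiltration h' a hlt)
  obtain ⟨_, ⟨a, rfl⟩, w, hw, rfl⟩ := Subgroup.mem_sup_of_normal_right.1 (hle hz)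
  exact ⟨a.toAdd, w, hw, rfl⟩

theorem mem_liftFiltration_succ (hφ : Function.Surjective φ) {m : ℕ}
    (hker : ∀ g, φ g = 1 ↔ ∀ i j : Fin n, i < j → (j : ℕ) < i + m → UTl.mat g i j = 0) {N : ℕ}
    {z : E} (hz : z ∈ hπ.liftFiltration φ N) (h1 : π z = 1) :
    z ∈ hπ.liftFiltration φ (N + 1) := by
  by_cases hpos : ∃ i j : Fin n, (i : ℕ) + ℓ + ℓ ≤ j ∧ entryRank i j = N
  · obtain ⟨i, j, h, rfl⟩ := hpos
    have hij := UTl.lt_of_add_le (le_of_add_add_le h)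
    obtain ⟨a, w, hw, rfl⟩ := hπ.exists_eq_lift_mul hφ h hz
    suffices hπ.lift φ i j h a = 1 by rwa [this, one_mul]
    -- If `φ` sees the position, the `(i, j)` entry of the product is `a`, because `g` vanishes
    -- there, and so `a = 0`. Otherwise `φ` kills the elementary matrix and `lift_eq_one` applies.
    by_cases hm : (j : ℕ) < i + m
    · obtain ⟨g, hg, hgw⟩ := hπ.exists_mem_filtration_of_mem_liftFiltration hw
      rw [map_mul, hπ.map_lift, ← hgw, ← map_mul, hker] at h1
      have ha := h1 i j hij hm
      rw [UTl.mat_elem_mul_apply, UTl.mat_diag, hg i j hij (Nat.lt_succ_self _), zero_add,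
        mul_one] at ha
      rw [ha, hπ.lift_zero]
    · refine hπ.lift_eq_one h ((hker _).2 fun k l hkl hlm => ?_)
      have : ¬ (i = k ∧ j = l) := by
        rintro ⟨rfl, rfl⟩
        exact hm hlm
      simp [UTl.mat_elem, this, Matrix.one_apply_ne hkl.ne]
  · refine (Subgroup.closure_mono ?_ : hπ.liftFiltration φ N ≤ _) hz
    rintro _ ⟨i, j, h, a, hN, rfl⟩
    exact ⟨i, j, h, a, hN.lt_of_ne fun heq => hpos ⟨i, j, h, heq.symm⟩, rfl⟩

include hπ in
theorem eq_one_of_mem_commutator (hφ : Function.Surjective φ) {m : ℕ}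
    (hker : ∀ g, φ g = 1 ↔ ∀ i j : Fin n, i < j → (j : ℕ) < i + m → UTl.mat g i j = 0)
    {z : E} (hz : z ∈ commutator E) (h1 : π z = 1) : z = 1 := by
  have h (N : ℕ) : z ∈ hπ.liftFiltration φ N := by
    induction N with
    | zero => exact hπ.commutator_le_liftFiltration hφ hz
    | succ N ih => exact hπ.mem_liftFiltration_succ hφ hker ih h1
  have hz := h (n * n)
  -- All ranks are below `n * n`, so no generators remain.
  rw [liftFiltration, Set.eq_empty_of_forall_notMem (s := {z | _}), Subgroup.closure_empty] at hz
  · exact hz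
  · rintro _ ⟨i, j, _, _, hN, _⟩
    exact (entryRank_lt i j).not_ge hN

end IsCommutingCentralExtension

/-! ### The three families of groups -/

theorem bogomolovMultiplier_eq_bot_of_UTl {n p ℓ : ℕ} [Fact p.Prime] [NeZero ℓ] {G : Type u}
    [Group G] {φ : UTl n p ℓ →* G} (hφ : Function.Surjective φ) {m : ℕ}
    (hker : ∀ g, φ g = 1 ↔ ∀ i j : Fin n, i < j → (j : ℕ) < i + m → UTl.mat g i j = 0) :
    bogomolovMultiplier G = ⊥ := by
  have : Finite G := Finite.of_surjective φ hφ
  exact bogomolovMultiplier_eq_bot_of_commutator_inf_ker fun E _ π hπ z hz h1 =>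
    hπ.eq_one_of_mem_commutator hφ hker hz h1

theorem UTl.eq_one_iff {n p ℓ : ℕ} [Fact p.Prime] (g : UTl n p ℓ) :
    g = 1 ↔ ∀ i j : Fin n, i < j → (j : ℕ) < i + n → UTl.mat g i j = 0 := by
  refine ⟨?_, fun h => UTl.ext_above fun i j hij => ?_⟩
  · rintro rfl i j hij _
    rw [map_one, Matrix.one_apply_ne hij.ne]
  · rw [h i j hij (by omega), map_one, Matrix.one_apply_ne hij.ne]

theorem bogomolovMultiplier_eq_bot_of_equiv_UTl {n p ℓ : ℕ} [Fact p.Prime] [NeZero ℓ] {G : Type u}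
    [Group G] (e : G ≃* UTl n p ℓ) : bogomolovMultiplier G = ⊥ :=
  -- With `m = n` the kernel condition covers every position above the diagonal.
  bogomolovMultiplier_eq_bot_of_UTl (φ := e.symm.toMonoidHom) e.symm.surjective (m := n) fun g =>
    (map_eq_one_iff e.symm e.symm.injective).trans (UTl.eq_one_iff g)

theorem bogomolovMultiplier_eq_bot_of_equiv_UT {n p : ℕ} [Fact p.Prime] {G : Type u}
    [Group G] (e : G ≃* UT n p) : bogomolovMultiplier G = ⊥ :=
  bogomolovMultiplier_eq_bot_of_equiv_UTl (ℓ := 1)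
    (e.trans (Subgroup.topEquiv.symm.trans (MulEquiv.subgroupCongr UTl_one.symm)))

theorem bogomolovMultiplier_eq_bot_of_equiv_UTQuotient {n p ℓ : ℕ} [Fact p.Prime] (hℓ : 1 ≤ ℓ)
    {G : Type u} [Group G] (e : G ≃* UTQuotient n p ℓ) : bogomolovMultiplier G = ⊥ := by
  have hlcs : lowerCentralTerm (UT n p) ℓ = UTl n p ℓ := by
    rw [lowerCentralTerm, lowerCentralSeries_UT, Nat.sub_add_cancel hℓ]
  let φ : UTl n p 1 →* G := e.symm.toMonoidHom.comp
    ((QuotientGroup.mk' (lowerCentralTerm (UT n p) ℓ)).comp (UTl n p 1).subtype)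
  -- Here the source is the whole of $UT_n$, as $UT_n^1$, and $\ell$ enters only as the bound `m`
  -- for the kernel $\gamma_\ell=UT_n^\ell$.
  refine bogomolovMultiplier_eq_bot_of_UTl (φ := φ) (m := ℓ) ?_ fun g => ?_
  · refine e.symm.surjective.comp ((QuotientGroup.mk'_surjective _).comp fun g => ?_)
    exact ⟨⟨g, UTl_one (n := n) (p := p) ▸ Subgroup.mem_top g⟩, rfl⟩
  · refine (map_eq_one_iff e.symm e.symm.injective).trans ((QuotientGroup.eq_one_iff _).trans ?_)
    rw [hlcs]
    rfl

theorem theorem3p1 (p : ℕ) [Fact p.Prime] (n : ℕ) (hn : 2 ≤ n) (G : Type u) [Group G]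
    (hG : Nonempty (G ≃* UT n p) ∨
      ∃ ℓ : ℕ, 1 ≤ ℓ ∧ ℓ + 2 ≤ n ∧
        (Nonempty (G ≃* UTl n p ℓ) ∨ Nonempty (G ≃* UTQuotient n p ℓ))) :
    bogomolovMultiplier G = ⊥ := by
  rcases hG with ⟨⟨e⟩⟩ | ⟨ℓ, hℓ, -, ⟨⟨e⟩⟩ | ⟨⟨e⟩⟩⟩
  · exact bogomolovMultiplier_eq_bot_of_equiv_UT e
  · have : NeZero ℓ := ⟨Nat.one_le_iff_ne_zero.1 hℓ⟩
    exact bogomolovMultiplier_eq_bot_of_equiv_UTl e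
  · exact bogomolovMultiplier_eq_bot_of_equiv_UTQuotient hℓ e
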